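/- Let $K\ge 2$ be an integer and let $a,b,\beta$ be real numbers with $0<b<a<1$, $0<\beta<1$ and $a+\beta\le 1$. Let $\mathbf B\in[0,1]^{K\times K}$ be the connectivity matrix of the homogeneous $K$-block stochastic blockmodel, $\mathbf B_{kk}=a$ and $\mathbf B_{k\ell}=b$ for $k\ne\ell$, and let $\mathbf B_Z\in[0,1]^{2K\times 2K}$, with rows and columns indexed by pairs $(k,z)$ of a block $k\in\{1,\dots,K\}$ and a value $z\in\{1,2\}$ of a binary covariate, be the connectivity matrix including the covariate effect, $(\mathbf B_Z)_{(k,z),(\ell,z')}=\mathbf B_{k\ell}+\beta\,\mathbf 1\{z=z'\}$. Take balanced block probabilities $\boldsymbol\pi=(\frac1K,\dots,\frac1K)$ and $\boldsymbol\pi_Z=(\frac1{2K},\dots,\frac1{2K})$. For a blockmodel with symmetric connectivity matrix $\mathbf M$ having $d_+$ positive and $d_-$ negative eigenvalues (with multiplicity) and block probabilities $(\pi_k)$, let $\mathbf I_{d_+d_-}=\mathrm{diag}(1,\dots,1,-1,\dots,-1)$ ($d_+$ ones, $d_-$ minus ones) and let $\boldsymbol\nu_k\in\mathbb R^{d_++d_-}$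 be any latent positions, i.e. vectors with $\boldsymbol\nu_k^\top\mathbf I_{d_+d_-}\boldsymbol\nu_\ell=\mathbf M_{k\ell}$ for all $k,\ell$. Put $$\boldsymbol\Delta=\sum_\ell\pi_\ell\boldsymbol\nu_\ell\boldsymbol\nu_\ell^\top,\quad \mathbf E_k=\sum_\ell\pi_\ell\,\mathbf M_{k\ell}(1-\mathbf M_{k\ell})\,\boldsymbol\nu_\ell\boldsymbol\nu_\ell^\top,\quad \boldsymbol\Sigma_k=\mathbf I_{d_+d_-}\boldsymbol\Delta^{-1}\mathbf E_k\boldsymbol\Delta^{-1}\mathbf I_{d_+d_-},$$ $\boldsymbol\Sigma_{k\ell}(t)=t\boldsymbol\Sigma_k+(1-t)\boldsymbol\Sigma_\ell$, $T_{k\ell}(t)=t(1-t)(\boldsymbol\nu_k-\boldsymbol\nu_\ell)^\top\boldsymbol\Sigma_{k\ell}(t)^{-1}(\boldsymbol\nu_k-\boldsymbol\nu_\ell)$ and $$\rho(n)=\min_{k\ne\ell}\sup_{t\in(0,1)}\Big[\tfrac n2\,T_{k\ell}(t)+\tfrac12\log\frac{|\boldsymbol\Sigma_{k\ell}(t)|}{|\boldsymbol\Sigma_k|^t|\boldsymbol\Sigma_\ell|^{1-t}}\Big],\qquad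 \rho^\ast=\min_{k\ne\ell}\sup_{t\in(0,1)}T_{k\ell}(t).$$ Let $\rho_1(n),\rho_1^\ast$ be these quantities for $(\mathbf B_Z,\boldsymbol\pi_Z)$ (clustering by the spectral embedding of the adjacency matrix, Algorithm 1) and $\rho_2(n),\rho_2^\ast$ those for $(\mathbf B,\boldsymbol\pi)$ (clustering after the covariate effect has been subtracted, Algorithm 2). Put $\phi_a=a(1-a)$, $\phi_b=b(1-b)$, $\phi_\beta=\beta(1-a-b-\beta)$ and $$D_3=K-2a-2(K-1)b-K\beta,\quad D_4=2\phi_a+2(K-1)\phi_b+\beta D_3,\quad \delta=K^2\beta^2(\phi_a+\phi_b+\phi_\beta)-2(a-b)^2D_4.$$ Then latent positions exist for both models, and for every choice of them $\boldsymbol\Delta$ is invertible, each $\boldsymbol\Sigma_k$ is positive definite, all the suprema are finite, $\rho_2^\ast>0$, and $$\lim_{n\to\infty}\frac{\rho_1(n)}{\rho_2(n)}=\frac{\rho_1^\ast}{\rho_2^\ast}=\begin{cases}\dfrac{K^2\beta^2(\phi_a+\phi_b)}{2(a-b)^2D_4}&\text{if }\delta\le 0,\\[2ex]\dfrac{\phi_a+\phi_b}{\phi_a+\phi_b+\phi_\beta}&\text{if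 }\delta>0,\end{cases}$$ where $D_4>0$ and $\phi_a+\phi_b+\phi_\beta>0$. -/

import Mathlib

open Filter Topology Matrix

namespace ChernoffSBM

/-- The matrix `I_{d₊ d₋} = diag(1, …, 1, -1, …, -1)`, with `p = d₊` and `m = d₋`. -/
def signature (p m : ℕ) : Matrix (Fin p ⊕ Fin m) (Fin p ⊕ Fin m) ℝ :=
  Matrix.diagonal (Sum.elim (fun _ => 1) (fun _ => -1))

/-- The indefinite inner product `xᵀ I_{d₊ d₋} y`. -/
def indefInner {p m : ℕ} (x y : Fin p ⊕ Fin m → ℝ) : ℝ :=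
  x ⬝ᵥ (signature p m *ᵥ y)

section Blocks

variable {ι : Type*} [Fintype ι] [DecidableEq ι]

open Classical in
/-- Number of strictly positive eigenvalues, counted with multiplicity. -/
noncomputable def numPosEig (B : Matrix ι ι ℝ) : ℕ :=
  B.charpoly.roots.countP (fun x => 0 < x)

open Classical in
/-- Number of strictly negative eigenvalues, counted with multiplicity. -/
noncomputable def numNegEig (B : Matrix ι ι ℝ) : ℕ :=
  B.charpoly.roots.countP (fun x => x < 0)

/-- `ν` is a family of block latent positions representing the stochastic blockmodel with block
connectivity probability matrix `B`: the embedding dimensions `d₊ = p`, `d₋ = m` are the numbers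
of positive and negative eigenvalues of `B`, and `ν_kᵀ I_{d₊ d₋} ν_ℓ = B_{kℓ}`. -/
structure IsLatentPosition (B : Matrix ι ι ℝ) {p m : ℕ} (ν : ι → Fin p ⊕ Fin m → ℝ) : Prop where
  pos_dim : p = numPosEig B
  neg_dim : m = numNegEig B
  inner_eq : ∀ k l, indefInner (ν k) (ν l) = B k l

variable {p m : ℕ} (w : ι → ℝ) (ν : ι → Fin p ⊕ Fin m → ℝ)

/-- `Δ = E[ν νᵀ]` for `ν ~ ∑ₖ wₖ δ_{νₖ}`. -/
def secondMoment : Matrix (Fin p ⊕ Fin m) (Fin p ⊕ Fin m) ℝ :=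
  ∑ l, w l • vecMulVec (ν l) (ν l)

/-- `E_k = E[(ν_kᵀ I ν) (1 - ν_kᵀ I ν) ν νᵀ]` for `ν ~ ∑ₗ wₗ δ_{νₗ}`. -/
def weightedMoment (k : ι) : Matrix (Fin p ⊕ Fin m) (Fin p ⊕ Fin m) ℝ :=
  ∑ l, w l • ((indefInner (ν k) (ν l) * (1 - indefInner (ν k) (ν l))) •
    vecMulVec (ν l) (ν l))

/-- The limiting covariance `Σ_k = I Δ⁻¹ E_k Δ⁻¹ I` of the adjacency spectral embedding. -/
noncomputable def cov (k : ι) : Matrix (Fin p ⊕ Fin m) (Fin p ⊕ Fin m) ℝ :=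
  signature p m * (secondMoment w ν)⁻¹ * weightedMoment w ν k * (secondMoment w ν)⁻¹ *
    signature p m

/-- `Σ_{kℓ}(t) = t Σ_k + (1 - t) Σ_ℓ`. -/
noncomputable def covMix (k l : ι) (t : ℝ) : Matrix (Fin p ⊕ Fin m) (Fin p ⊕ Fin m) ℝ :=
  t • cov w ν k + (1 - t) • cov w ν l

/-- `t (1 - t) (ν_k - ν_ℓ)ᵀ Σ_{kℓ}(t)⁻¹ (ν_k - ν_ℓ)`. -/
noncomputable def leadingTerm (k l : ι) (t : ℝ) : ℝ :=
  t * (1 - t) * ((ν k - ν l) ⬝ᵥ ((covMix w ν k l t)⁻¹ *ᵥ (ν k - ν l)))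

/-- `(1/2) n t (1 - t) (ν_k - ν_ℓ)ᵀ Σ_{kℓ}(t)⁻¹ (ν_k - ν_ℓ)
      + (1/2) log (|Σ_{kℓ}(t)| / (|Σ_k|ᵗ |Σ_ℓ|¹⁻ᵗ))`. -/
noncomputable def chernoffTerm (n : ℕ) (k l : ι) (t : ℝ) : ℝ :=
  1 / 2 * (n : ℝ) * leadingTerm w ν k l t +
    1 / 2 * Real.log ((covMix w ν k l t).det /
      ((cov w ν k).det ^ t * (cov w ν l).det ^ (1 - t)))

/-- The Chernoff information `ρ` at sample size `n`: the minimum over pairs of distinct blocks of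
the supremum over `t ∈ (0, 1)` of `chernoffTerm`. -/
noncomputable def rho (n : ℕ) : ℝ :=
  ⨅ q : {q : ι × ι // q.1 ≠ q.2}, ⨆ t : Set.Ioo (0 : ℝ) 1, chernoffTerm w ν n q.1.1 q.1.2 t

/-- The same min-sup without the factor `n / 2` and without the logarithmic term. -/
noncomputable def rhoLim : ℝ :=
  ⨅ q : {q : ι × ι // q.1 ≠ q.2}, ⨆ t : Set.Ioo (0 : ℝ) 1, leadingTerm w ν q.1.1 q.1.2 t

/-- All inverses, determinants and suprema entering `rho` and `rhoLim` are genuine: `Δ` is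
invertible, the limiting covariances are positive definite, the suprema are finite. -/
structure WellPosed : Prop where
  isUnit_det : IsUnit (secondMoment w ν).det
  posDef_cov : ∀ k, (cov w ν k).PosDef
  bddAbove_chernoff : ∀ (n : ℕ) (k l : ι), k ≠ l →
    BddAbove (Set.range fun t : Set.Ioo (0 : ℝ) 1 => chernoffTerm w ν n k l t)
  bddAbove_leading : ∀ k l : ι, k ≠ l →
    BddAbove (Set.range fun t : Set.Ioo (0 : ℝ) 1 => leadingTerm w ν k l t)

end Blocks

/-- The `K`-block homogeneous model: `a` on the diagonal, `b` off the diagonal. -/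
def homogeneousB (K : ℕ) (a b : ℝ) : Matrix (Fin K) (Fin K) ℝ :=
  Matrix.of fun k l => if k = l then a else b

/-- The `2K`-block connectivity matrix including the effect `β` of a binary covariate; the block
`(k, z)` consists of the vertices of block `k` with covariate value `z`. -/
def withBinaryCovariate {K : ℕ} (B : Matrix (Fin K) (Fin K) ℝ) (β : ℝ) :
    Matrix (Fin K × Fin 2) (Fin K × Fin 2) ℝ :=
  Matrix.of fun x y => B x.1 y.1 + β * (if x.2 = y.2 then 1 else 0)

/-- Balanced block assignment probabilities `(1/K, …, 1/K)`. -/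
noncomputable def balanced (K : ℕ) : Fin K → ℝ := fun _ => 1 / (K : ℝ)

/-- Balanced block assignment probabilities `(1/(2K), …, 1/(2K))`. -/
noncomputable def balancedZ (K : ℕ) : Fin K × Fin 2 → ℝ := fun _ => 1 / (2 * (K : ℝ))

/-- `φ_x = x (1 - x)`. -/
def phi (x : ℝ) : ℝ := x * (1 - x)

/-- `φ_β = β (1 - a - b - β)`. -/
def phiBeta (a b β : ℝ) : ℝ := β * (1 - a - b - β)

/-- `D₃ = K - 2a - 2(K-1)b - Kβ`. -/
def D₃ (K : ℕ) (a b β : ℝ) : ℝ := K - 2 * a - 2 * ((K : ℝ) - 1) * b - K * β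

/-- `D₄ = 2φ_a + 2(K-1)φ_b + β D₃`. -/
def D₄ (K : ℕ) (a b β : ℝ) : ℝ := 2 * phi a + 2 * ((K : ℝ) - 1) * phi b + β * D₃ K a b β

/-- `δ = K²β²(φ_a + φ_b + φ_β) - 2(a-b)² D₄`. -/
def discr (K : ℕ) (a b β : ℝ) : ℝ :=
  (K : ℝ) ^ 2 * β ^ 2 * (phi a + phi b + phiBeta a b β) - 2 * (a - b) ^ 2 * D₄ K a b β

open Classical in
/-- The closed form of the limiting Chernoff ratio. -/
noncomputable def closedForm (K : ℕ) (a b β : ℝ) : ℝ :=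
  if discr K a b β ≤ 0 then
    (K : ℝ) ^ 2 * β ^ 2 * (phi a + phi b) / (2 * (a - b) ^ 2 * D₄ K a b β)
  else
    (phi a + phi b) / (phi a + phi b + phiBeta a b β)

end ChernoffSBM

namespace ChernoffSBM

/-! Both connectivity matrices are positive semidefinite, so $d_-=0$, the signature is the identity
and the latent positions span the embedding space. The logarithmic term is continuous, hence
bounded, on $[0,1]$; since infima and suprema are 1-Lipschitz for the uniform norm, $\rho(n)=\frac
n2\rho^\ast+O(1)$ (`exists_abs_rho_sub_le`), and the ratio tends to $\rho_1^\ast/\rho_2^\ast$.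

To find $\rho^\ast$ no covariance is inverted. With $v=\nu_i-\nu_j$ and $S=\Sigma_{ij}(t)$, $v^\top
S^{-1}v=\max_y(2v^\top y-y^\top Sy)$. Writing $y=\Delta u$ cancels the factors $\Delta^{-1}$ in $S$
and leaves `objective`, a sum of one-variable quadratics in $g_l=\nu_l^\top u$ whose coefficients
are entries of the connectivity matrix (`two_mul_dotProduct_sub_eq_objective`). A test vector
proportional to a difference of latent positions, at $t=\frac12$, gives the lower bounds. Completing
squares on pairs of cells with exchanged variances gives matching upper bounds for all $t$
(`swap_pair_le`).

With the covariate, the $g_l$ are constrained: the latent positions form a parallelogram. This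
allows the linear terms to be redistributed among the pairs in proportion to their variances, which
makes the upper bounds sharp. Then $\rho_1^\ast$ is the smaller of the value for two communities and
the value for two covariate levels of one community; the sign of $\delta$ says which. -/

theorem signature_zero (p : ℕ) : signature p 0 = 1 := by
  rw [signature, ← Matrix.diagonal_one]
  congr 1
  ext (i | i)
  · rfl
  · exact i.elim0

theorem indefInner_eq_dotProduct {p m : ℕ} (hs : signature p m = 1) (x y : Fin p ⊕ Fin m → ℝ) :
    indefInner x y = x ⬝ᵥ y := by
  rw [indefInner, hs, one_mulVec]

/-! ### Latent positions of positive semidefinite blockmodels. -/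

section PositiveSemidefinite

variable {ι : Type*} [Fintype ι] [DecidableEq ι] {M : Matrix ι ι ℝ}

theorem numNegEig_eq_zero (hM : M.PosSemidef) : numNegEig M = 0 := by
  classical
  rw [numNegEig, hM.isHermitian.roots_charpoly_eq_eigenvalues, Multiset.countP_eq_zero]
  intro x hx
  obtain ⟨i, -, rfl⟩ := Multiset.mem_map.1 hx
  exact not_lt.2 (hM.eigenvalues_nonneg i)

theorem numPosEig_eq_card (hM : M.PosSemidef) :
    numPosEig M = Fintype.card {i // hM.isHermitian.eigenvalues i ≠ 0} := by
  classical
  rw [numPosEig, hM.isHermitian.roots_charpoly_eq_eigenvalues, Multiset.countP_map,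
    Fintype.card_subtype, Finset.card_def, Finset.filter_val]
  congr 1
  refine Multiset.filter_congr fun i _ => ?_
  exact (hM.eigenvalues_nonneg i).lt_iff_ne'

theorem numPosEig_eq_rank (hM : M.PosSemidef) : numPosEig M = M.rank := by
  rw [numPosEig_eq_card hM, hM.isHermitian.rank_eq_card_non_zero_eigs]

theorem PosSemidef.apply_eq_sum (hM : M.PosSemidef) (k l : ι) :
    M k l = ∑ i, hM.isHermitian.eigenvalues i *
      ((hM.isHermitian.eigenvectorUnitary : Matrix ι ι ℝ) k i *
        (hM.isHermitian.eigenvectorUnitary : Matrix ι ι ℝ) l i) := by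
  have h := congrFun (congrFun hM.isHermitian.spectral_theorem k) l
  rw [h, Unitary.conjStarAlgAut_apply, Matrix.mul_apply]
  refine Finset.sum_congr rfl fun i _ => ?_
  rw [Matrix.mul_diagonal, Matrix.star_apply]
  simp
  ring

/-- The coordinates are the eigenvector entries scaled by $\sqrt{\lambda_i}$, kept only for
$\lambda_i\ne0$ so that the dimension is exactly the number of positive eigenvalues. -/
theorem exists_isLatentPosition (hM : M.PosSemidef) :
    ∃ (p m : ℕ) (ν : ι → Fin p ⊕ Fin m → ℝ), IsLatentPosition M ν := by
  let U : Matrix ι ι ℝ := (hM.isHermitian.eigenvectorUnitary : Matrix ι ι ℝ)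
  let ev := hM.isHermitian.eigenvalues
  let e : Fin (numPosEig M) ≃ {i // ev i ≠ 0} :=
    (finCongr (numPosEig_eq_card hM)).trans (Fintype.equivFin _).symm
  refine ⟨numPosEig M, 0, fun k => Sum.elim (fun i => √(ev (e i)) * U k (e i)) Fin.elim0, rfl,
    (numNegEig_eq_zero hM).symm, fun k l => ?_⟩
  rw [indefInner_eq_dotProduct (signature_zero _), PosSemidef.apply_eq_sum hM, dotProduct,
    Fintype.sum_sum_type]
  simp only [Sum.elim_inl, Finset.univ_eq_empty, Finset.sum_empty, add_zero]
  rw [e.sum_comp fun i : {i // ev i ≠ 0} => √(ev i) * U k i * (√(ev i) * U l i),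
    ← Finset.sum_subtype (Finset.univ.filter fun i => ev i ≠ 0) (by simp)
      fun i => √(ev i) * U k i * (√(ev i) * U l i), Finset.sum_filter_of_ne]
  · refine Finset.sum_congr rfl fun i _ => ?_
    linear_combination (U k i * U l i) * Real.mul_self_sqrt (hM.eigenvalues_nonneg i)
  · intro i _ h h0
    simp [h0] at h

variable {p m : ℕ} {ν : ι → Fin p ⊕ Fin m → ℝ}

theorem IsLatentPosition.signature_eq_one (hM : M.PosSemidef) (hν : IsLatentPosition M ν) :
    signature p m = 1 := by
  obtain rfl : m = 0 := hν.neg_dim.trans (numNegEig_eq_zero hM)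
  exact signature_zero p

theorem IsLatentPosition.dotProduct_eq (hM : M.PosSemidef) (hν : IsLatentPosition M ν) (k l : ι) :
    ν k ⬝ᵥ ν l = M k l := by
  rw [← hν.inner_eq, indefInner_eq_dotProduct (hν.signature_eq_one hM)]

/-- Latent positions of a positive semidefinite blockmodel span the embedding space. -/
theorem IsLatentPosition.eq_zero_of_dotProduct_eq_zero (hM : M.PosSemidef)
    (hν : IsLatentPosition M ν) {u : Fin p ⊕ Fin m → ℝ} (hu : ∀ l, ν l ⬝ᵥ u = 0) : u = 0 := by
  let X : Matrix ι (Fin p ⊕ Fin m) ℝ := Matrix.of ν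
  have hX : M = X * Xᵀ := by
    ext k l
    rw [← hν.dotProduct_eq hM, Matrix.mul_apply']
    rfl
  have hrank : M.rank ≤ X.rank := hX ▸ Matrix.rank_mul_le_left X Xᵀ
  have hm : m = 0 := hν.neg_dim.trans (numNegEig_eq_zero hM)
  have hp : p = M.rank := hν.pos_dim.trans (numPosEig_eq_rank hM)
  have hker := LinearMap.finrank_range_add_finrank_ker X.mulVecLin
  rw [Module.finrank_fintype_fun_eq_card, Fintype.card_sum, Fintype.card_fin, Fintype.card_fin]
    at hker
  change X.rank + _ = _ at hker
  -- Rank–nullity: $X$ has $p=\operatorname{rank}M\le\operatorname{rank}X$ columns, so its kernel is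
  -- trivial.
  have hbot : LinearMap.ker X.mulVecLin = ⊥ := Submodule.finrank_eq_zero.1 (by omega)
  exact LinearMap.ker_eq_bot'.1 hbot u (funext hu)

end PositiveSemidefinite

/-! ### Moment matrices and positive definiteness of the covariances. -/

section Moments

variable {ι : Type*} [Fintype ι] {p m : ℕ} {w : ι → ℝ}
  {ν : ι → Fin p ⊕ Fin m → ℝ}

/-- `∑ₗ cₗ νₗ νₗᵀ`. -/
def outerSum (c : ι → ℝ) (ν : ι → Fin p ⊕ Fin m → ℝ) : Matrix (Fin p ⊕ Fin m) (Fin p ⊕ Fin m) ℝ :=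
  ∑ l, c l • vecMulVec (ν l) (ν l)

theorem secondMoment_eq_outerSum : secondMoment w ν = outerSum w ν := rfl

theorem weightedMoment_eq_outerSum (k : ι) : weightedMoment w ν k =
    outerSum (fun l => w l * phi (indefInner (ν k) (ν l))) ν := by
  simp only [weightedMoment, outerSum, phi, smul_smul]

theorem dotProduct_outerSum_mulVec (c : ι → ℝ) (x y : Fin p ⊕ Fin m → ℝ) :
    x ⬝ᵥ (outerSum c ν *ᵥ y) = ∑ l, c l * ((ν l ⬝ᵥ x) * (ν l ⬝ᵥ y)) := by
  rw [outerSum, Matrix.sum_mulVec, dotProduct_sum]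
  refine Finset.sum_congr rfl fun l _ => ?_
  rw [Matrix.smul_mulVec, dotProduct_smul, Matrix.vecMulVec_mulVec, op_smul_eq_smul,
    dotProduct_smul, smul_eq_mul, smul_eq_mul, dotProduct_comm x]
  ring

theorem outerSum_isHermitian (c : ι → ℝ) : (outerSum c ν).IsHermitian := by
  rw [Matrix.IsHermitian, conjTranspose_eq_transpose_of_trivial, outerSum, Matrix.transpose_sum]
  refine Finset.sum_congr rfl fun l _ => ?_
  rw [Matrix.transpose_smul, Matrix.transpose_vecMulVec]

theorem outerSum_posDef {c : ι → ℝ} (hc : ∀ l, 0 ≤ c l)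
    (hspan : ∀ u, (∀ l, 0 < c l → ν l ⬝ᵥ u = 0) → u = 0) : (outerSum c ν).PosDef := by
  refine PosDef.of_dotProduct_mulVec_pos (outerSum_isHermitian c) fun u hu => ?_
  rw [star_trivial, dotProduct_outerSum_mulVec]
  have hterm : ∀ l, 0 ≤ c l * ((ν l ⬝ᵥ u) * (ν l ⬝ᵥ u)) :=
    fun l => mul_nonneg (hc l) (mul_self_nonneg _)
  refine lt_of_le_of_ne (Finset.sum_nonneg fun l _ => hterm l) fun h => hu (hspan u fun l hl => ?_)
  have := (Finset.sum_eq_zero_iff_of_nonneg fun l _ => hterm l).1 h.symm l (Finset.mem_univ l)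
  simpa [hl.ne'] using this

theorem cov_eq (hs : signature p m = 1) (k : ι) :
    cov w ν k = (secondMoment w ν)⁻¹ * weightedMoment w ν k * (secondMoment w ν)⁻¹ := by
  rw [cov, hs, Matrix.one_mul, Matrix.mul_one]

theorem cov_posDef (hs : signature p m = 1) (hΔ : (secondMoment w ν).PosDef) {k : ι}
    (hE : (weightedMoment w ν k).PosDef) : (cov w ν k).PosDef := by
  have hinv := hΔ.inv
  have := (IsUnit.posDef_star_left_conjugate_iff hinv.isUnit).2 hE
  rwa [star_eq_conjTranspose, hinv.isHermitian, ← cov_eq hs] at this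

theorem covMix_eq (hs : signature p m = 1) (k l : ι) (t : ℝ) :
    covMix w ν k l t = (secondMoment w ν)⁻¹ *
      (t • weightedMoment w ν k + (1 - t) • weightedMoment w ν l) * (secondMoment w ν)⁻¹ := by
  rw [covMix, cov_eq hs, cov_eq hs, Matrix.mul_add, Matrix.add_mul]
  simp only [Matrix.mul_smul, Matrix.smul_mul]

theorem covMix_posDef {k l : ι} (hk : (cov w ν k).PosDef) (hl : (cov w ν l).PosDef) {t : ℝ}
    (ht : t ∈ Set.Icc (0 : ℝ) 1) : (covMix w ν k l t).PosDef := by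
  rcases ht.1.eq_or_lt with rfl | h0
  · simpa [covMix] using hl
  · exact (hk.smul h0).add_posSemidef (hl.posSemidef.smul (sub_nonneg.2 ht.2))

/-- Expand $(y-S^{-1}v)^\top S(y-S^{-1}v)\ge0$; equality holds at $y=S^{-1}v$. -/
theorem PosDef.two_mul_dotProduct_sub_le {n : Type*} [Fintype n] [DecidableEq n]
    {S : Matrix n n ℝ} (hS : S.PosDef) (v y : n → ℝ) :
    2 * (v ⬝ᵥ y) - y ⬝ᵥ (S *ᵥ y) ≤ v ⬝ᵥ (S⁻¹ *ᵥ v) := by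
  have hdet : IsUnit S.det := (Matrix.isUnit_iff_isUnit_det S).1 hS.isUnit
  have h := hS.posSemidef.dotProduct_mulVec_nonneg (y - S⁻¹ *ᵥ v)
  have hsymm : (S⁻¹ *ᵥ v) ⬝ᵥ (S *ᵥ y) = v ⬝ᵥ y := by
    rw [Matrix.dotProduct_mulVec, ← Matrix.mulVec_transpose,
      ← conjTranspose_eq_transpose_of_trivial, hS.isHermitian, Matrix.mulVec_mulVec,
      Matrix.mul_nonsing_inv _ hdet, Matrix.one_mulVec]
  rw [star_trivial, Matrix.mulVec_sub, Matrix.mulVec_mulVec, Matrix.mul_nonsing_inv _ hdet,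
    Matrix.one_mulVec, sub_dotProduct, dotProduct_sub, dotProduct_sub, hsymm, dotProduct_comm y v,
    dotProduct_comm _ v] at h
  linarith

end Moments

/-! ### Variational form of the Mahalanobis distance. -/

section Variational

variable {ι : Type*} [Fintype ι] {p m : ℕ} {w : ι → ℝ} {ν : ι → Fin p ⊕ Fin m → ℝ}

/-- The concave functional whose maximum over `g l = ⟨ν l, u⟩` is the Mahalanobis distance between
the blocks `i` and `j`. -/
def objective (w : ι → ℝ) (M : Matrix ι ι ℝ) (i j : ι) (t : ℝ) (g : ι → ℝ) : ℝ :=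
  ∑ l, w l * (2 * (M i l - M j l) * g l - (t * phi (M i l) + (1 - t) * phi (M j l)) * g l ^ 2)

variable {M : Matrix ι ι ℝ} (hs : signature p m = 1) (hdot : ∀ k l, ν k ⬝ᵥ ν l = M k l)
  (hΔ : (secondMoment w ν).PosDef)

-- In the variable $y=\Delta u$ the quadratic form of $\Delta^{-1}E\Delta^{-1}$ becomes $u^\top Eu$,
-- which is diagonal in the numbers $\nu_l^\top u$.
include hs hdot hΔ in
theorem two_mul_dotProduct_sub_eq_objective (i j : ι) (t : ℝ) (u : Fin p ⊕ Fin m → ℝ) :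
    2 * ((ν i - ν j) ⬝ᵥ (secondMoment w ν *ᵥ u)) -
      (secondMoment w ν *ᵥ u) ⬝ᵥ (covMix w ν i j t *ᵥ (secondMoment w ν *ᵥ u)) =
    objective w M i j t fun l => ν l ⬝ᵥ u := by
  have hdet : IsUnit (secondMoment w ν).det := (Matrix.isUnit_iff_isUnit_det _).1 hΔ.isUnit
  have hquad : (secondMoment w ν *ᵥ u) ⬝ᵥ (covMix w ν i j t *ᵥ (secondMoment w ν *ᵥ u)) =
      u ⬝ᵥ ((t • weightedMoment w ν i + (1 - t) • weightedMoment w ν j) *ᵥ u) := by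
    rw [covMix_eq hs, Matrix.mulVec_mulVec, Matrix.mul_assoc, Matrix.nonsing_inv_mul _ hdet,
      Matrix.mul_one, ← Matrix.mulVec_mulVec, Matrix.dotProduct_mulVec, ← Matrix.mulVec_transpose,
      ← conjTranspose_eq_transpose_of_trivial, hΔ.inv.isHermitian, Matrix.mulVec_mulVec,
      Matrix.nonsing_inv_mul _ hdet, Matrix.one_mulVec]
  rw [hquad, Matrix.add_mulVec, dotProduct_add, Matrix.smul_mulVec, Matrix.smul_mulVec,
    dotProduct_smul, dotProduct_smul, weightedMoment_eq_outerSum, weightedMoment_eq_outerSum,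
    secondMoment_eq_outerSum, dotProduct_outerSum_mulVec, dotProduct_outerSum_mulVec,
    dotProduct_outerSum_mulVec, objective, smul_eq_mul, smul_eq_mul, Finset.mul_sum,
    Finset.mul_sum, Finset.mul_sum, ← Finset.sum_add_distrib, ← Finset.sum_sub_distrib]
  refine Finset.sum_congr rfl fun l _ => ?_
  rw [dotProduct_sub, hdot, hdot, indefInner_eq_dotProduct hs, indefInner_eq_dotProduct hs, hdot,
    hdot, ← hdot l i, dotProduct_comm, hdot, ← hdot l j, dotProduct_comm (ν l) (ν j), hdot]
  ring

include hs hdot hΔ in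
theorem le_leadingTerm {i j : ι} (hi : (cov w ν i).PosDef) (hj : (cov w ν j).PosDef) {t : ℝ}
    (ht : t ∈ Set.Ioo (0 : ℝ) 1) (u : Fin p ⊕ Fin m → ℝ) :
    t * (1 - t) * objective w M i j t (fun l => ν l ⬝ᵥ u) ≤ leadingTerm w ν i j t := by
  refine mul_le_mul_of_nonneg_left ?_ (mul_nonneg ht.1.le (sub_nonneg.2 ht.2.le))
  rw [← two_mul_dotProduct_sub_eq_objective hs hdot hΔ]
  exact PosDef.two_mul_dotProduct_sub_le (covMix_posDef hi hj (Set.Ioo_subset_Icc_self ht)) _ _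

include hs hdot hΔ in
theorem exists_leadingTerm_eq {i j : ι} (hi : (cov w ν i).PosDef) (hj : (cov w ν j).PosDef) {t : ℝ}
    (ht : t ∈ Set.Ioo (0 : ℝ) 1) : ∃ u : Fin p ⊕ Fin m → ℝ,
    leadingTerm w ν i j t = t * (1 - t) * objective w M i j t (fun l => ν l ⬝ᵥ u) := by
  have hdet : IsUnit (secondMoment w ν).det := (Matrix.isUnit_iff_isUnit_det _).1 hΔ.isUnit
  have hdet' : IsUnit (covMix w ν i j t).det := (Matrix.isUnit_iff_isUnit_det _).1
    (covMix_posDef hi hj (Set.Ioo_subset_Icc_self ht)).isUnit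
  -- Chosen so that $\Delta u=S^{-1}(\nu_i-\nu_j)$, the maximizer.
  refine ⟨(secondMoment w ν)⁻¹ *ᵥ ((covMix w ν i j t)⁻¹ *ᵥ (ν i - ν j)), ?_⟩
  rw [← two_mul_dotProduct_sub_eq_objective hs hdot hΔ, leadingTerm,
    Matrix.mulVec_mulVec (M := secondMoment w ν), Matrix.mul_nonsing_inv _ hdet, Matrix.one_mulVec,
    Matrix.mulVec_mulVec _ (covMix w ν i j t), Matrix.mul_nonsing_inv _ hdet', Matrix.one_mulVec,
    dotProduct_comm _ (ν i - ν j)]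
  ring

/-- Spanning is asked only of the $\nu_l$ with positive variance, because $\varphi$ vanishes at an
entry equal to $1$, which occurs when $a+\beta=1$. -/
theorem weightedMoment_posDef {k : ι} (hw : ∀ l, 0 < w l) (hs : signature p m = 1)
    (hdot : ∀ k l, ν k ⬝ᵥ ν l = M k l) (hφ : ∀ l, 0 ≤ phi (M k l))
    (hspan : ∀ u, (∀ l, 0 < phi (M k l) → ν l ⬝ᵥ u = 0) → u = 0) :
    (weightedMoment w ν k).PosDef := by
  rw [weightedMoment_eq_outerSum]
  simp only [indefInner_eq_dotProduct hs, hdot]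
  exact outerSum_posDef (fun l => mul_nonneg (hw l).le (hφ l)) fun u hu =>
    hspan u fun l hl => hu l (mul_pos (hw l) hl)

end Variational

/-! ### Reduction of the ratio of $\rho(n)$ to the ratio of $\rho^\ast$. -/

section Asymptotics

variable {ι : Type*} [Fintype ι] {p m : ℕ} {w : ι → ℝ} {ν : ι → Fin p ⊕ Fin m → ℝ}

/-- The bracket `log (|Σ_{kℓ}(t)| / (|Σ_k|ᵗ |Σ_ℓ|¹⁻ᵗ))`. -/
noncomputable def logDetTerm (w : ι → ℝ) (ν : ι → Fin p ⊕ Fin m → ℝ) (k l : ι) (t : ℝ) : ℝ :=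
  Real.log ((covMix w ν k l t).det / ((cov w ν k).det ^ t * (cov w ν l).det ^ (1 - t)))

theorem continuous_covMix (k l : ι) : Continuous (covMix w ν k l) := by
  unfold covMix
  fun_prop

theorem bddAbove_range_Ioo {f : ℝ → ℝ} (hf : ContinuousOn f (Set.Icc 0 1)) :
    BddAbove (Set.range fun t : Set.Ioo (0 : ℝ) 1 => f t) := by
  refine (isCompact_Icc.bddAbove_image hf).mono ?_
  rintro _ ⟨t, rfl⟩
  exact ⟨t, Set.Ioo_subset_Icc_self t.2, rfl⟩

section

variable {k l : ι} (hk : (cov w ν k).PosDef) (hl : (cov w ν l).PosDef)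

include hk hl in
theorem continuousOn_leadingTerm : ContinuousOn (leadingTerm w ν k l) (Set.Icc 0 1) := by
  have hinv : ContinuousOn (fun t => (covMix w ν k l t)⁻¹) (Set.Icc 0 1) := by
    simp only [Matrix.inv_def, Ring.inverse_eq_inv']
    exact ((continuous_covMix k l).matrix_det.continuousOn.inv₀ fun t ht =>
      (covMix_posDef hk hl ht).det_pos.ne').smul
      (continuous_covMix k l).matrix_adjugate.continuousOn
  unfold leadingTerm
  refine ContinuousOn.mul (by fun_prop) ?_
  have hlin : Continuous fun A : Matrix (Fin p ⊕ Fin m) (Fin p ⊕ Fin m) ℝ =>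
      (ν k - ν l) ⬝ᵥ (A *ᵥ (ν k - ν l)) := by fun_prop
  exact hlin.comp_continuousOn hinv

include hk hl in
theorem continuousOn_logDetTerm : ContinuousOn (logDetTerm w ν k l) (Set.Icc 0 1) := by
  unfold logDetTerm
  have hpow : Continuous fun t : ℝ => (cov w ν k).det ^ t * (cov w ν l).det ^ (1 - t) :=
    (Real.continuous_const_rpow hk.det_pos.ne').mul
      ((Real.continuous_const_rpow hl.det_pos.ne').comp (by fun_prop))
  have hpos : ∀ t : ℝ, 0 < (cov w ν k).det ^ t * (cov w ν l).det ^ (1 - t) := fun t =>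
    mul_pos (Real.rpow_pos_of_pos hk.det_pos _) (Real.rpow_pos_of_pos hl.det_pos _)
  refine ContinuousOn.log ?_ fun t ht =>
    (div_pos (covMix_posDef hk hl ht).det_pos (hpos t)).ne'
  exact (continuous_covMix k l).matrix_det.continuousOn.div hpow.continuousOn
    fun t _ => (hpos t).ne'

end

theorem chernoffTerm_eq (n : ℕ) (k l : ι) (t : ℝ) : chernoffTerm w ν n k l t =
    1 / 2 * (n : ℝ) * leadingTerm w ν k l t + 1 / 2 * logDetTerm w ν k l t := rfl

theorem wellPosed_of_posDef (hΔ : (secondMoment w ν).PosDef) (hcov : ∀ k, (cov w ν k).PosDef) :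
    WellPosed w ν where
  isUnit_det := (Matrix.isUnit_iff_isUnit_det _).1 hΔ.isUnit
  posDef_cov := hcov
  bddAbove_chernoff _ k l _ := bddAbove_range_Ioo <|
    (continuousOn_const.mul (continuousOn_leadingTerm (hcov k) (hcov l))).add
      (continuousOn_const.mul (continuousOn_logDetTerm (hcov k) (hcov l)))
  bddAbove_leading k l _ := bddAbove_range_Ioo (continuousOn_leadingTerm (hcov k) (hcov l))

theorem exists_abs_logDetTerm_le (hcov : ∀ k, (cov w ν k).PosDef) :
    ∃ C, ∀ k l, ∀ t ∈ Set.Icc (0 : ℝ) 1, |logDetTerm w ν k l t| ≤ C := by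
  have h : ∀ q : ι × ι, ∃ C, ∀ t ∈ Set.Icc (0 : ℝ) 1, |logDetTerm w ν q.1 q.2 t| ≤ C := fun q =>
    isCompact_Icc.exists_bound_of_continuousOn
      (continuousOn_logDetTerm (hcov q.1) (hcov q.2))
  choose C hC using h
  obtain ⟨D, hD⟩ := Finite.bddAbove_range C
  exact ⟨D, fun k l t ht => (hC (k, l) t ht).trans (hD ⟨(k, l), rfl⟩)⟩

theorem ciSup_sub_ciSup_abs_le {α : Type*} [Nonempty α] {f g : α → ℝ} {C : ℝ}
    (hg : BddAbove (Set.range g)) (h : ∀ x, |f x - g x| ≤ C) : |(⨆ x, f x) - ⨆ x, g x| ≤ C := by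
  have hf : BddAbove (Set.range f) := by
    obtain ⟨D, hD⟩ := hg
    refine ⟨D + C, ?_⟩
    rintro _ ⟨x, rfl⟩
    linarith [hD ⟨x, rfl⟩, (abs_le.1 (h x)).2]
  rw [abs_le]
  constructor
  · have : ⨆ x, g x ≤ (⨆ x, f x) + C :=
      ciSup_le fun x => by linarith [le_ciSup hf x, (abs_le.1 (h x)).1]
    linarith
  · have : ⨆ x, f x ≤ (⨆ x, g x) + C :=
      ciSup_le fun x => by linarith [le_ciSup hg x, (abs_le.1 (h x)).2]
    linarith

theorem ciInf_sub_ciInf_abs_le {α : Type*} [Nonempty α] [Finite α] {f g : α → ℝ} {C : ℝ}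
    (h : ∀ x, |f x - g x| ≤ C) : |(⨅ x, f x) - ⨅ x, g x| ≤ C := by
  rw [abs_le]
  constructor
  · have : (⨅ x, g x) - C ≤ ⨅ x, f x := le_ciInf fun x => by
      linarith [ciInf_le (Finite.bddBelow_range g) x, (abs_le.1 (h x)).1]
    linarith
  · have : (⨅ x, f x) - C ≤ ⨅ x, g x := le_ciInf fun x => by
      linarith [ciInf_le (Finite.bddBelow_range f) x, (abs_le.1 (h x)).2]
    linarith

instance : Nonempty (Set.Ioo (0 : ℝ) 1) := ⟨⟨1 / 2, by norm_num⟩⟩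

/-- The logarithmic term is bounded uniformly in $t$ and in the pair, and passing to suprema and
minima does not enlarge a uniform error. -/
theorem exists_abs_rho_sub_le [Nontrivial ι] (hw : WellPosed w ν) :
    ∃ C, ∀ n : ℕ, |rho w ν n - 1 / 2 * n * rhoLim w ν| ≤ C := by
  obtain ⟨C, hC⟩ := exists_abs_logDetTerm_le hw.posDef_cov
  have : Nonempty {q : ι × ι // q.1 ≠ q.2} := by
    obtain ⟨x, y, hxy⟩ := exists_pair_ne ι
    exact ⟨⟨(x, y), hxy⟩⟩
  refine ⟨1 / 2 * C, fun n => ?_⟩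
  have hn : (0 : ℝ) ≤ 1 / 2 * n := by positivity
  rw [rho, rhoLim, Real.mul_iInf_of_nonneg hn]
  refine ciInf_sub_ciInf_abs_le fun q => ?_
  rw [Real.mul_iSup_of_nonneg hn]
  refine ciSup_sub_ciSup_abs_le ?_ fun t => ?_
  · obtain ⟨D, hD⟩ := hw.bddAbove_leading q.1.1 q.1.2 q.2
    refine ⟨1 / 2 * n * D, ?_⟩
    rintro _ ⟨t, rfl⟩
    exact mul_le_mul_of_nonneg_left (hD ⟨t, rfl⟩) hn
  · rw [chernoffTerm_eq, add_sub_cancel_left, abs_mul, abs_of_pos one_half_pos]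
    exact mul_le_mul_of_nonneg_left (hC _ _ _ (Set.Ioo_subset_Icc_self t.2)) one_half_pos.le

theorem tendsto_rho_div [Nontrivial ι] (hw : WellPosed w ν) :
    Tendsto (fun n : ℕ => rho w ν n / n) atTop (𝓝 (1 / 2 * rhoLim w ν)) := by
  obtain ⟨C, hC⟩ := exists_abs_rho_sub_le hw
  rw [tendsto_iff_norm_sub_tendsto_zero]
  refine squeeze_zero' (Eventually.of_forall fun n => norm_nonneg _) ?_
    (tendsto_const_div_atTop_nhds_zero_nat C)
  filter_upwards [eventually_gt_atTop 0] with n hn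
  have hn' : (0 : ℝ) < n := Nat.cast_pos.2 hn
  have hdiv : rho w ν n / n - 1 / 2 * rhoLim w ν = (rho w ν n - 1 / 2 * n * rhoLim w ν) / n := by
    field_simp
  rw [Real.norm_eq_abs, hdiv, abs_div, abs_of_pos hn']
  exact div_le_div_of_nonneg_right (hC n) hn'.le

theorem tendsto_rho_div_rho {κ : Type*} [Fintype κ] {q r : ℕ} {v : κ → ℝ}
    {μ : κ → Fin q ⊕ Fin r → ℝ} [Nontrivial ι] [Nontrivial κ] (hw : WellPosed w ν)
    (hv : WellPosed v μ) (hpos : 0 < rhoLim v μ) :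
    Tendsto (fun n : ℕ => rho w ν n / rho v μ n) atTop (𝓝 (rhoLim w ν / rhoLim v μ)) := by
  have h := (tendsto_rho_div hw).div (tendsto_rho_div hv) (by positivity)
  rw [mul_div_mul_left _ _ (by norm_num)] at h
  refine h.congr' ?_
  filter_upwards [eventually_gt_atTop 0] with n hn
  exact div_div_div_cancel_right₀ (Nat.cast_pos.2 hn).ne' _ _

theorem le_rhoLim [Nontrivial ι] (hw : WellPosed w ν) {c : ℝ} {t : ℝ}
    (ht : t ∈ Set.Ioo (0 : ℝ) 1) (h : ∀ k l, k ≠ l → c ≤ leadingTerm w ν k l t) :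
    c ≤ rhoLim w ν := by
  have : Nonempty {q : ι × ι // q.1 ≠ q.2} := by
    obtain ⟨x, y, hxy⟩ := exists_pair_ne ι
    exact ⟨⟨(x, y), hxy⟩⟩
  exact le_ciInf fun q => (h _ _ q.2).trans
    (le_ciSup (hw.bddAbove_leading _ _ q.2) (⟨t, ht⟩ : Set.Ioo (0 : ℝ) 1))

theorem rhoLim_le {c : ℝ} {k l : ι} (hkl : k ≠ l)
    (h : ∀ t ∈ Set.Ioo (0 : ℝ) 1, leadingTerm w ν k l t ≤ c) : rhoLim w ν ≤ c :=
  (ciInf_le (Finite.bddBelow_range _) (⟨(k, l), hkl⟩ : {q : ι × ι // q.1 ≠ q.2})).trans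
    (ciSup_le fun t => h t t.2)

end Asymptotics

/-! ### Sums over blocks and the elementary inequalities. -/

section Sums

theorem sum_eq_add_of_ne {K : ℕ} {k l : Fin K} (hkl : k ≠ l) {F : Fin K → ℝ}
    (hF : ∀ j, k ≠ j → l ≠ j → F j = 0) : ∑ j, F j = F k + F l :=
  Fintype.sum_eq_add k l hkl fun j hj => hF j hj.1.symm hj.2.symm

theorem sum_le_add_of_nonpos {K : ℕ} {k l : Fin K} (hkl : k ≠ l) {F : Fin K → ℝ}
    (hF : ∀ j, k ≠ j → l ≠ j → F j ≤ 0) : ∑ j, F j ≤ F k + F l := by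
  have h := sum_eq_add_of_ne hkl (F := fun j => if k = j ∨ l = j then F j else 0)
    fun j hk hl => by simp [hk, hl]
  simp only [true_or, or_true, if_true] at h
  rw [← h]
  refine Finset.sum_le_sum fun j _ => ?_
  split_ifs with hj
  · exact le_rfl
  · rw [not_or] at hj
    exact hF j hj.1 hj.2

theorem sum_ite_const {K : ℕ} (k : Fin K) (x y : ℝ) :
    ∑ j, (if k = j then x else y) = x + ((K : ℝ) - 1) * y := by
  have h : ∀ j, (if k = j then x else y) = (if k = j then x - y else 0) + y := fun j => by
    split_ifs <;> ring
  simp only [h, Finset.sum_add_distrib, Finset.sum_ite_eq, Finset.mem_univ, if_true,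
    Finset.sum_const, Finset.card_univ, Fintype.card_fin, nsmul_eq_mul]
  ring

theorem two_mul_sub_le_div {c d x : ℝ} (hd : 0 < d) : 2 * c * x - d * x ^ 2 ≤ c ^ 2 / d := by
  rw [le_div_iff₀ hd]
  nlinarith [sq_nonneg (c - d * x)]

/-- Interchanging the roles of two cells gives the maximum over `t` at `t = 1 / 2`. -/
theorem swap_pair_le {A B t : ℝ} (hA : 0 ≤ A) (hB : 0 < B) (ht : t ∈ Set.Ioo (0 : ℝ) 1)
    (γ x y : ℝ) :
    t * (1 - t) * (2 * (γ * (A + B)) * (x - y) - (t * A + (1 - t) * B) * x ^ 2 -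
      (t * B + (1 - t) * A) * y ^ 2) ≤ γ ^ 2 * (A + B) := by
  obtain ⟨h0, h1⟩ := ht
  have h1 : 0 < 1 - t := sub_pos.2 h1
  have hp : 0 < t * A + (1 - t) * B := add_pos_of_nonneg_of_pos (by positivity) (by positivity)
  have hq : 0 < t * B + (1 - t) * A := add_pos_of_pos_of_nonneg (by positivity) (by positivity)
  have hx := two_mul_sub_le_div (c := γ * (A + B)) (x := x) hp
  -- The second cell has the opposite linear coefficient, hence $-y$.
  have hy := two_mul_sub_le_div (c := γ * (A + B)) (x := -y) hq
  calc _ ≤ t * (1 - t) * ((γ * (A + B)) ^ 2 / (t * A + (1 - t) * B) +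
        (γ * (A + B)) ^ 2 / (t * B + (1 - t) * A)) :=
        mul_le_mul_of_nonneg_left (by linarith [hx, hy]) (by positivity)
    _ ≤ γ ^ 2 * (A + B) := by
      rw [div_add_div _ _ hp.ne' hq.ne', ← mul_div_assoc, div_le_iff₀ (by positivity)]
      -- With $p,q$ the two mixed variances, $p+q=A+B$ and $pq-t(1-t)(A+B)^2=AB(1-2t)^2$.
      have : 0 ≤ γ ^ 2 * (A + B) * (A * B * (1 - 2 * t) ^ 2) := by positivity
      linarith

end Sums

/-! ### The connectivity matrices and their variances. -/

section Entries

variable {K : ℕ} {a b β : ℝ}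

theorem phi_pos {x : ℝ} (h0 : 0 < x) (h1 : x < 1) : 0 < phi x := mul_pos h0 (sub_pos.2 h1)

theorem phi_nonneg {x : ℝ} (h0 : 0 ≤ x) (h1 : x ≤ 1) : 0 ≤ phi x := mul_nonneg h0 (sub_nonneg.2 h1)

theorem homogeneousB_apply (k l : Fin K) :
    homogeneousB K a b k l = if k = l then a else b := rfl

theorem withBinaryCovariate_apply (x y : Fin K × Fin 2) :
    withBinaryCovariate (homogeneousB K a b) β x y =
      (if x.1 = y.1 then a else b) + β * (if x.2 = y.2 then 1 else 0) := rfl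

theorem homogeneousB_posSemidef (hb : 0 ≤ b) (hba : b ≤ a) :
    (homogeneousB K a b).PosSemidef := by
  have h : homogeneousB K a b = (a - b) • (1 : Matrix (Fin K) (Fin K) ℝ) +
      b • (1 : Matrix Unit Unit ℝ).submatrix (fun _ => ()) fun _ => () := by
    ext k l
    by_cases hkl : k = l <;> simp [homogeneousB_apply, hkl]
  rw [h]
  exact (PosSemidef.one.smul (sub_nonneg.2 hba)).add ((PosSemidef.one.submatrix _).smul hb)

theorem withBinaryCovariate_posSemidef {B : Matrix (Fin K) (Fin K) ℝ} (hB : B.PosSemidef)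
    (hβ : 0 ≤ β) : (withBinaryCovariate B β).PosSemidef := by
  have h : withBinaryCovariate B β = B.submatrix Prod.fst Prod.fst +
      β • (1 : Matrix (Fin 2) (Fin 2) ℝ).submatrix Prod.snd Prod.snd := by
    ext x y
    simp [withBinaryCovariate, Matrix.one_apply]
  rw [h]
  exact (hB.submatrix _).add ((PosSemidef.one.submatrix _).smul hβ)

/-- So $D_4$ is the sum of the variances $\varphi$ along a row of $\mathbf B_Z$, from which its
positivity is clear. -/
theorem D₄_eq : D₄ K a b β =
    (phi (a + β) + phi a) + ((K : ℝ) - 1) * (phi (b + β) + phi b) := by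
  simp only [D₄, D₃, phi]
  ring

theorem two_mul_phi_add_eq : 2 * (phi a + phi b + phiBeta a b β) =
    (phi (a + β) + phi (b + β)) + (phi a + phi b) := by
  simp only [phi, phiBeta]
  ring

end Entries

/-! ### The value of $\rho_2^\ast$. -/

section WithoutCovariate

variable {K : ℕ} {a b : ℝ} (hb : 0 < b) (hba : b < a) (ha : a < 1)
  {p m : ℕ} {ν : Fin K → Fin p ⊕ Fin m → ℝ} (hν : IsLatentPosition (homogeneousB K a b) ν)

theorem secondMoment_posDef {ι : Type*} [Fintype ι] [DecidableEq ι] {M : Matrix ι ι ℝ}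
    (hM : M.PosSemidef) {p m : ℕ} {ν : ι → Fin p ⊕ Fin m → ℝ} (hν : IsLatentPosition M ν)
    {w : ι → ℝ} (hw : ∀ l, 0 < w l) : (secondMoment w ν).PosDef :=
  outerSum_posDef (fun l => (hw l).le) fun _ hu =>
    hν.eq_zero_of_dotProduct_eq_zero hM fun l => hu l (hw l)

include hb hba ha in
theorem phi_homogeneousB_pos (k l : Fin K) : 0 < phi (homogeneousB K a b k l) := by
  rw [homogeneousB_apply]
  split_ifs
  · exact phi_pos (hb.trans hba) ha
  · exact phi_pos hb (hba.trans ha)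

include hb hba ha hν in
theorem cov_balanced_posDef (k : Fin K) : (cov (balanced K) ν k).PosDef := by
  have hM := homogeneousB_posSemidef (K := K) hb.le hba.le
  have hw : ∀ l, 0 < balanced K l := fun l => by
    have : 0 < K := l.pos
    unfold balanced
    positivity
  exact cov_posDef (hν.signature_eq_one hM) (secondMoment_posDef hM hν hw)
    (weightedMoment_posDef hw (hν.signature_eq_one hM) (hν.dotProduct_eq hM)
      (fun l => (phi_homogeneousB_pos hb hba ha k l).le) fun u hu =>
        hν.eq_zero_of_dotProduct_eq_zero hM fun l => hu l (phi_homogeneousB_pos hb hba ha k l))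

include hb hba hν in
theorem secondMoment_balanced_posDef : (secondMoment (balanced K) ν).PosDef :=
  secondMoment_posDef (homogeneousB_posSemidef hb.le hba.le) hν fun l => by
    have : 0 < K := l.pos
    unfold balanced
    positivity

include hb hba ha hν in
theorem wellPosed_balanced : WellPosed (balanced K) ν :=
  wellPosed_of_posDef (secondMoment_balanced_posDef hb hba hν) (cov_balanced_posDef hb hba ha hν)

theorem objective_balanced_eq {k l : Fin K} (hkl : k ≠ l) (γ : ℝ) :
    objective (balanced K) (homogeneousB K a b) k l (1 / 2)
      (fun j => γ * (homogeneousB K a b j k - homogeneousB K a b j l)) =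
    1 / K * (4 * (a - b) ^ 2 * γ - (a - b) ^ 2 * (phi a + phi b) * γ ^ 2) := by
  unfold objective
  rw [sum_eq_add_of_ne hkl]
  · simp only [homogeneousB_apply, hkl, hkl.symm, if_true, if_false, balanced]
    ring
  · intro j hk hl
    simp [homogeneousB_apply, hk, hl, hk.symm, hl.symm]

include hb hba ha hν in
theorem rhoLim_balanced (hK : 2 ≤ K) :
    rhoLim (balanced K) ν = (a - b) ^ 2 / (K * (phi a + phi b)) := by
  have : Nontrivial (Fin K) := Fin.nontrivial_iff_two_le.2 hK
  have hK0 : (0 : ℝ) < K := Nat.cast_pos.2 (by omega)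
  have hM := homogeneousB_posSemidef (K := K) hb.le hba.le
  have hs := hν.signature_eq_one hM
  have hdot := hν.dotProduct_eq hM
  have hΔ := secondMoment_balanced_posDef hb hba hν
  have hcov := cov_balanced_posDef hb hba ha hν
  have hpa : 0 < phi a := phi_pos (hb.trans hba) ha
  have hpb : 0 < phi b := phi_pos hb (hba.trans ha)
  apply le_antisymm
  · obtain ⟨k, l, hkl⟩ := exists_pair_ne (Fin K)
    refine rhoLim_le hkl fun t ht => ?_
    obtain ⟨u, hu⟩ := exists_leadingTerm_eq hs hdot hΔ (hcov k) (hcov l) ht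
    have ht0 := ht.1
    have ht1 : 0 < 1 - t := sub_pos.2 ht.2
    rw [hu, objective]
    refine (mul_le_mul_of_nonneg_left (sum_le_add_of_nonpos hkl ?_) (by positivity)).trans ?_
    -- Outside the two communities the linear coefficient vanishes and only a nonpositive square
    -- remains.
    · intro j hk hl
      simp only [homogeneousB_apply, hk, hl, if_false, balanced]
      have : 0 ≤ 1 / (K : ℝ) * (phi b * (ν j ⬝ᵥ u) ^ 2) := by positivity
      linarith
    · have h := swap_pair_le hpa.le hpb ht ((a - b) / (phi a + phi b)) (ν k ⬝ᵥ u) (ν l ⬝ᵥ u)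
      rw [div_mul_cancel₀ _ (by positivity)] at h
      simp only [homogeneousB_apply, hkl, hkl.symm, if_true, if_false, balanced]
      have h' := mul_le_mul_of_nonneg_left h (one_div_pos.2 hK0).le
      have e : (a - b) ^ 2 / (K * (phi a + phi b)) =
          1 / K * (((a - b) / (phi a + phi b)) ^ 2 * (phi a + phi b)) := by
        field_simp
      rw [e]
      refine le_trans (le_of_eq ?_) h'
      ring
  · refine le_rhoLim (t := 1 / 2) (wellPosed_balanced hb hba ha hν) (by norm_num)
      fun k l hkl => ?_
    refine le_trans (le_of_eq ?_) (le_leadingTerm hs hdot hΔ (hcov k) (hcov l) (by norm_num)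
      -- The factor maximizes the quadratic in $\gamma$ of `objective_balanced_eq`.
      ((2 / (phi a + phi b)) • (ν k - ν l)))
    simp only [dotProduct_smul, dotProduct_sub, hdot, smul_eq_mul]
    rw [objective_balanced_eq hkl]
    field_simp
    ring

end WithoutCovariate

/-! ### The value of $\rho_1^\ast$ and the closed form. -/

section WithCovariate

variable {K : ℕ} {a b β : ℝ}

theorem objective_balancedZ_eq (x y : Fin K × Fin 2) (t : ℝ) (g : Fin K × Fin 2 → ℝ) :
    objective (balancedZ K) (withBinaryCovariate (homogeneousB K a b) β) x y t g =
    1 / (2 * K) * ∑ j, ∑ c : Fin 2,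
      (2 * (withBinaryCovariate (homogeneousB K a b) β x (j, c) -
        withBinaryCovariate (homogeneousB K a b) β y (j, c)) * g (j, c) -
      (t * phi (withBinaryCovariate (homogeneousB K a b) β x (j, c)) +
        (1 - t) * phi (withBinaryCovariate (homogeneousB K a b) β y (j, c))) * g (j, c) ^ 2) := by
  rw [objective, Fintype.sum_prod_type, Finset.mul_sum]
  simp only [Finset.mul_sum, balancedZ]

/-- Blocks with different community labels. -/
theorem objective_balancedZ_eq_of_ne {k l : Fin K} (hkl : k ≠ l) (z z' : Fin 2) (γ : ℝ) :
    objective (balancedZ K) (withBinaryCovariate (homogeneousB K a b) β) (k, z) (l, z') (1 / 2)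
      (fun x => γ * (withBinaryCovariate (homogeneousB K a b) β x (k, z) -
        withBinaryCovariate (homogeneousB K a b) β x (l, z))) =
    1 / (2 * K) * (8 * (a - b) ^ 2 * γ -
      2 * (a - b) ^ 2 * (phi a + phi b + phiBeta a b β) * γ ^ 2) := by
  rw [objective_balancedZ_eq, sum_eq_add_of_ne hkl]
  · congr 1
    rw [mul_right_comm 2 ((a - b) ^ 2), two_mul_phi_add_eq]
    fin_cases z <;> fin_cases z' <;>
    · simp only [withBinaryCovariate_apply, hkl, hkl.symm, Fin.sum_univ_two, if_true, if_false,
        Fin.zero_eta, Fin.mk_one, zero_ne_one, one_ne_zero, mul_one, mul_zero, add_zero]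
      ring
  · intro j hk hl
    simp [withBinaryCovariate_apply, hk.symm, hl.symm]

/-- Blocks with the same community label. -/
theorem objective_balancedZ_eq_of_eq (k : Fin K) {z z' : Fin 2} (hz : z ≠ z') (γ : ℝ) :
    objective (balancedZ K) (withBinaryCovariate (homogeneousB K a b) β) (k, z) (k, z') (1 / 2)
      (fun x => γ * (withBinaryCovariate (homogeneousB K a b) β x (k, z) -
        withBinaryCovariate (homogeneousB K a b) β x (k, z'))) =
    1 / (2 * K) * (4 * K * β ^ 2 * γ - β ^ 2 * D₄ K a b β * γ ^ 2) := by
  rw [objective_balancedZ_eq]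
  congr 1
  have h : 4 * K * β ^ 2 * γ - β ^ 2 * D₄ K a b β * γ ^ 2 = ∑ j, if k = j then
      4 * β ^ 2 * γ - β ^ 2 * (phi (a + β) + phi a) * γ ^ 2 else
      4 * β ^ 2 * γ - β ^ 2 * (phi (b + β) + phi b) * γ ^ 2 := by
    rw [sum_ite_const, D₄_eq]
    ring
  rw [h]
  refine Finset.sum_congr rfl fun j _ => ?_
  by_cases hk : k = j
  · fin_cases z <;> fin_cases z' <;> first | exact absurd rfl hz |
    · simp only [withBinaryCovariate_apply, hk, Fin.sum_univ_two, if_true, if_false,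
        Fin.zero_eta, Fin.mk_one, zero_ne_one, one_ne_zero, mul_one, mul_zero, add_zero]
      ring
  · have hk' : j ≠ k := Ne.symm hk
    fin_cases z <;> fin_cases z' <;> first | exact absurd rfl hz |
    · simp only [withBinaryCovariate_apply, hk, hk', Fin.sum_univ_two, if_true, if_false,
        Fin.zero_eta, Fin.mk_one, zero_ne_one, one_ne_zero, mul_one, mul_zero, add_zero]
      ring

theorem balancedZ_pos (x : Fin K × Fin 2) : 0 < balancedZ K x := by
  have : 0 < K := x.1.pos
  unfold balancedZ
  positivity

variable (hb : 0 < b) (hba : b < a) (hβ : 0 < β) (haβ : a + β ≤ 1)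

include hb hba hβ haβ

theorem phi_add_phi_add_phiBeta_pos : 0 < phi a + phi b + phiBeta a b β := by
  have h1 : 0 < phi a := phi_pos (hb.trans hba) (by linarith)
  have h2 : 0 < phi b := phi_pos hb (by linarith)
  have h3 : 0 ≤ phi (a + β) := phi_nonneg (by linarith) haβ
  have h4 : 0 < phi (b + β) := phi_pos (by linarith) (by linarith)
  linarith [two_mul_phi_add_eq (a := a) (b := b) (β := β)]

theorem D₄_pos (hK : 2 ≤ K) : 0 < D₄ K a b β := by
  have h1 : 0 < phi a := phi_pos (hb.trans hba) (by linarith)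
  have h2 : 0 < phi b := phi_pos hb (by linarith)
  have h3 : 0 ≤ phi (a + β) := phi_nonneg (by linarith) haβ
  have h4 : 0 < phi (b + β) := phi_pos (by linarith) (by linarith)
  have hK' : (2 : ℝ) ≤ K := by exact_mod_cast hK
  have h5 : 0 ≤ ((K : ℝ) - 1) * (phi (b + β) + phi b) := mul_nonneg (by linarith) (by linarith)
  rw [D₄_eq]
  linarith

theorem phi_withBinaryCovariate_nonneg (x y : Fin K × Fin 2) :
    0 ≤ phi (withBinaryCovariate (homogeneousB K a b) β x y) := by
  rw [withBinaryCovariate_apply]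
  apply phi_nonneg <;> split_ifs <;> linarith

theorem phi_withBinaryCovariate_pos {x y : Fin K × Fin 2} (hxy : x ≠ y) :
    0 < phi (withBinaryCovariate (homogeneousB K a b) β x y) := by
  rw [withBinaryCovariate_apply]
  split_ifs with h1 h2 h2
  · exact absurd (Prod.ext h1 h2) hxy
  all_goals apply phi_pos <;> linarith

omit haβ in
theorem withBinaryCovariate_homogeneousB_posSemidef :
    (withBinaryCovariate (homogeneousB K a b) β).PosSemidef :=
  withBinaryCovariate_posSemidef (homogeneousB_posSemidef hb.le hba.le) hβ.le

variable {p m : ℕ} {ν : Fin K × Fin 2 → Fin p ⊕ Fin m → ℝ}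
  (hν : IsLatentPosition (withBinaryCovariate (homogeneousB K a b) β) ν)

include hν

omit haβ in
/-- The latent positions of the blocks form a parallelogram. -/
theorem dotProduct_sub_eq_dotProduct_sub (u : Fin p ⊕ Fin m → ℝ) (k l : Fin K) (z z' : Fin 2) :
    ν (k, z) ⬝ᵥ u - ν (k, z') ⬝ᵥ u = ν (l, z) ⬝ᵥ u - ν (l, z') ⬝ᵥ u := by
  have hM := withBinaryCovariate_homogeneousB_posSemidef (K := K) hb hba hβ
  -- In $\nu_{(k,z)}-\nu_{(k,z')}$ the community part of the Gram entries cancels and the covariate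
  -- part does not depend on $k$; so this vector is orthogonal to every latent position.
  have h : ν (k, z) - ν (k, z') - (ν (l, z) - ν (l, z')) = 0 := by
    refine hν.eq_zero_of_dotProduct_eq_zero hM fun x => ?_
    simp only [dotProduct_sub, hν.dotProduct_eq hM, withBinaryCovariate_apply]
    ring
  rw [← sub_dotProduct, ← sub_dotProduct, sub_eq_zero.1 h]

omit haβ in
theorem secondMoment_balancedZ_posDef : (secondMoment (balancedZ K) ν).PosDef :=
  secondMoment_posDef (withBinaryCovariate_homogeneousB_posSemidef hb hba hβ) hν balancedZ_pos

/-- When $a+\beta=1$ the block $x$ has weight zero in its own $\mathbf E_x$. The remaining latent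
positions still span, since $\nu_x$ is the fourth vertex of a parallelogram; a second community is
needed for this. -/
theorem cov_balancedZ_posDef (hK : 2 ≤ K) (x : Fin K × Fin 2) :
    (cov (balancedZ K) ν x).PosDef := by
  have hM := withBinaryCovariate_homogeneousB_posSemidef (K := K) hb hba hβ
  refine cov_posDef (hν.signature_eq_one hM) (secondMoment_balancedZ_posDef hb hba hβ hν)
    (weightedMoment_posDef balancedZ_pos (hν.signature_eq_one hM) (hν.dotProduct_eq hM)
      (phi_withBinaryCovariate_nonneg hb hba hβ haβ x) fun u hu => ?_)
  have hne : ∀ y, x ≠ y → ν y ⬝ᵥ u = 0 := fun y hy =>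
    hu y (phi_withBinaryCovariate_pos hb hba hβ haβ hy)
  have : Nontrivial (Fin K) := Fin.nontrivial_iff_two_le.2 hK
  obtain ⟨l, hl⟩ := exists_ne x.1
  obtain ⟨z, hz⟩ := exists_ne x.2
  refine hν.eq_zero_of_dotProduct_eq_zero hM fun y => ?_
  by_cases hxy : x = y
  · have h := dotProduct_sub_eq_dotProduct_sub hb hba hβ hν u x.1 l x.2 z
    rw [hne (x.1, z) fun h => hz (congrArg Prod.snd h).symm,
      hne (l, x.2) fun h => hl (congrArg Prod.fst h).symm,
      hne (l, z) fun h => hl (congrArg Prod.fst h).symm, sub_zero, sub_zero] at h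
    exact hxy ▸ h
  · exact hne y hxy

theorem wellPosed_balancedZ (hK : 2 ≤ K) : WellPosed (balancedZ K) ν :=
  wellPosed_of_posDef (secondMoment_balancedZ_posDef hb hba hβ hν)
    (cov_balancedZ_posDef hb hba hβ haβ hν hK)

/-- The test vector uses one covariate value $z$ for both communities even if $z\ne z'$: then $g$
does not depend on the covariate and the $\beta$-terms cancel. Hence pairs differing in both labels
cannot lower the minimum. -/
theorem le_leadingTerm_balancedZ_of_ne (hK : 2 ≤ K) {k l : Fin K} (hkl : k ≠ l) (z z' : Fin 2) :
    (a - b) ^ 2 / (K * (phi a + phi b + phiBeta a b β)) ≤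
      leadingTerm (balancedZ K) ν (k, z) (l, z') (1 / 2) := by
  have hM := withBinaryCovariate_homogeneousB_posSemidef (K := K) hb hba hβ
  have hdot := hν.dotProduct_eq hM
  have hcov := cov_balancedZ_posDef hb hba hβ haβ hν hK
  have hS := phi_add_phi_add_phiBeta_pos hb hba hβ haβ
  have hK0 : (0 : ℝ) < K := Nat.cast_pos.2 (by omega)
  refine le_trans (le_of_eq ?_) (le_leadingTerm (hν.signature_eq_one hM) hdot
    (secondMoment_balancedZ_posDef hb hba hβ hν) (hcov _) (hcov _) (by norm_num)
    ((2 / (phi a + phi b + phiBeta a b β)) • (ν (k, z) - ν (l, z))))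
  simp only [dotProduct_smul, dotProduct_sub, hdot, smul_eq_mul]
  rw [objective_balancedZ_eq_of_ne hkl]
  field_simp
  ring

theorem le_leadingTerm_balancedZ_of_eq (hK : 2 ≤ K) (k : Fin K) {z z' : Fin 2} (hz : z ≠ z') :
    K * β ^ 2 / (2 * D₄ K a b β) ≤ leadingTerm (balancedZ K) ν (k, z) (k, z') (1 / 2) := by
  have hM := withBinaryCovariate_homogeneousB_posSemidef (K := K) hb hba hβ
  have hdot := hν.dotProduct_eq hM
  have hcov := cov_balancedZ_posDef hb hba hβ haβ hν hK
  have hD := D₄_pos hb hba hβ haβ hK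
  have hK0 : (0 : ℝ) < K := Nat.cast_pos.2 (by omega)
  refine le_trans (le_of_eq ?_) (le_leadingTerm (hν.signature_eq_one hM) hdot
    (secondMoment_balancedZ_posDef hb hba hβ hν) (hcov _) (hcov _) (by norm_num)
    -- The maximizer in $\gamma$ of $4K\beta^2\gamma-\beta^2D_4\gamma^2$.
    ((2 * K / D₄ K a b β) • (ν (k, z) - ν (k, z'))))
  simp only [dotProduct_smul, dotProduct_sub, hdot, smul_eq_mul]
  rw [objective_balancedZ_eq_of_eq k hz]
  field_simp
  ring

theorem leadingTerm_balancedZ_le_of_ne (hK : 2 ≤ K) {k l : Fin K} (hkl : k ≠ l) {t : ℝ}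
    (ht : t ∈ Set.Ioo (0 : ℝ) 1) : leadingTerm (balancedZ K) ν (k, 0) (l, 0) t ≤
      (a - b) ^ 2 / (K * (phi a + phi b + phiBeta a b β)) := by
  have hM := withBinaryCovariate_homogeneousB_posSemidef (K := K) hb hba hβ
  have hcov := cov_balancedZ_posDef hb hba hβ haβ hν hK
  obtain ⟨u, hu⟩ := exists_leadingTerm_eq (hν.signature_eq_one hM) (hν.dotProduct_eq hM)
    (secondMoment_balancedZ_posDef hb hba hβ hν) (hcov (k, 0)) (hcov (l, 0)) ht
  have hS := phi_add_phi_add_phiBeta_pos hb hba hβ haβ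
  have hK0 : (0 : ℝ) < K := Nat.cast_pos.2 (by omega)
  have hpar := dotProduct_sub_eq_dotProduct_sub hb hba hβ hν u k l 0 1
  have ht0 := ht.1
  have ht1 : 0 < 1 - t := sub_pos.2 ht.2
  have hpa : 0 < phi a := phi_pos (hb.trans hba) (by linarith)
  have hpb : 0 < phi b := phi_pos hb (by linarith)
  have hpaβ : 0 ≤ phi (a + β) := phi_nonneg (by linarith) haβ
  have hpbβ : 0 < phi (b + β) := phi_pos (by linarith) (by linarith)
  -- By the parallelogram law the differences $g_{(k,z)}-g_{(l,z)}$ agree for both $z$, so only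
  -- their total coefficient matters. It is split in proportion to the variance sums of the two
  -- pairs; `hγS` says that the total is preserved.
  set γ := (a - b) / (phi a + phi b + phiBeta a b β) with hγ
  have hγS : γ * ((phi (a + β) + phi (b + β)) + (phi a + phi b)) = 2 * (a - b) := by
    rw [← two_mul_phi_add_eq, hγ]
    field_simp
  have h0 := swap_pair_le hpaβ hpbβ ht γ (ν (k, 0) ⬝ᵥ u) (ν (l, 0) ⬝ᵥ u)
  have h1 := swap_pair_le hpa.le hpb ht γ (ν (k, 1) ⬝ᵥ u) (ν (l, 1) ⬝ᵥ u)
  rw [hu, objective_balancedZ_eq, mul_left_comm]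
  have e : (a - b) ^ 2 / (K * (phi a + phi b + phiBeta a b β)) =
      1 / (2 * K) * (γ ^ 2 * (phi (a + β) + phi (b + β)) + γ ^ 2 * (phi a + phi b)) := by
    rw [← mul_add, ← two_mul_phi_add_eq, hγ]
    field_simp
  rw [e]
  refine mul_le_mul_of_nonneg_left ?_ (by positivity)
  refine (mul_le_mul_of_nonneg_left (sum_le_add_of_nonpos hkl ?_) (by positivity)).trans ?_
  · intro j hk hl
    simp only [withBinaryCovariate_apply, hk, hl, if_false, Fin.sum_univ_two, if_true,
      zero_ne_one, mul_one, mul_zero, add_zero]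
    have h2 : 0 ≤ phi (b + β) * (ν (j, 0) ⬝ᵥ u) ^ 2 := by positivity
    have h3 : 0 ≤ phi b * (ν (j, 1) ⬝ᵥ u) ^ 2 := by positivity
    linarith
  · refine le_trans (le_of_eq ?_) (add_le_add h0 h1)
    simp only [withBinaryCovariate_apply, hkl, hkl.symm, if_false, Fin.sum_univ_two, if_true,
      zero_ne_one, mul_one, mul_zero, add_zero]
    linear_combination t * (1 - t) * (-(2 * γ * (phi (a + β) + phi (b + β))) * hpar) +
      t * (1 - t) * 2 * (a - b) * hpar - 2 * t * (1 - t) * (ν (k, 1) ⬝ᵥ u - ν (l, 1) ⬝ᵥ u) * hγS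

theorem leadingTerm_balancedZ_le_of_eq (hK : 2 ≤ K) (k : Fin K) {t : ℝ}
    (ht : t ∈ Set.Ioo (0 : ℝ) 1) : leadingTerm (balancedZ K) ν (k, 0) (k, 1) t ≤
      K * β ^ 2 / (2 * D₄ K a b β) := by
  have hM := withBinaryCovariate_homogeneousB_posSemidef (K := K) hb hba hβ
  have hcov := cov_balancedZ_posDef hb hba hβ haβ hν hK
  obtain ⟨u, hu⟩ := exists_leadingTerm_eq (hν.signature_eq_one hM) (hν.dotProduct_eq hM)
    (secondMoment_balancedZ_posDef hb hba hβ hν) (hcov (k, 0)) (hcov (k, 1)) ht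
  have hD := D₄_pos hb hba hβ haβ hK
  have hK0 : (0 : ℝ) < K := Nat.cast_pos.2 (by omega)
  have hpar := fun j => dotProduct_sub_eq_dotProduct_sub hb hba hβ hν u j k 0 1
  have hpa : 0 < phi a := phi_pos (hb.trans hba) (by linarith)
  have hpb : 0 < phi b := phi_pos hb (by linarith)
  have hpaβ : 0 ≤ phi (a + β) := phi_nonneg (by linarith) haβ
  have hpbβ : 0 < phi (b + β) := phi_pos (by linarith) (by linarith)
  -- All the differences $g_{(j,0)}-g_{(j,1)}$ equal $H$, so the $K$ coefficients $\beta$ may be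
  -- replaced by $\gamma s_j$ with the same sum $K\beta$; as $\sum_j s_j=D_4$, this fixes $\gamma$.
  set γ := K * β / D₄ K a b β with hγ
  set H := ν (k, 0) ⬝ᵥ u - ν (k, 1) ⬝ᵥ u
  let s : Fin K → ℝ := fun j => if k = j then phi (a + β) + phi a else phi (b + β) + phi b
  have hsum : ∑ j, s j = D₄ K a b β := by
    rw [D₄_eq]
    exact sum_ite_const k _ _
  rw [hu, objective_balancedZ_eq, mul_left_comm]
  have e : K * β ^ 2 / (2 * D₄ K a b β) = 1 / (2 * K) * ∑ j, γ ^ 2 * s j := by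
    rw [← Finset.mul_sum, hsum, hγ]
    field_simp
  rw [e]
  refine mul_le_mul_of_nonneg_left ?_ (by positivity)
  -- The net change made by the redistribution; adding it lets each $j$ be bounded separately.
  have hzero : ∑ j, t * (1 - t) * (2 * H * (γ * s j - β)) = 0 := by
    rw [← Finset.mul_sum, ← Finset.mul_sum, Finset.sum_sub_distrib, ← Finset.mul_sum, hsum, hγ,
      div_mul_cancel₀ _ hD.ne']
    simp
  rw [Finset.mul_sum, ← add_zero (Finset.sum _ _), ← hzero, ← Finset.sum_add_distrib]
  refine Finset.sum_le_sum fun j _ => ?_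
  by_cases hk : k = j
  · subst hk
    refine le_trans (le_of_eq ?_) ((swap_pair_le hpaβ hpa ht γ (ν (k, 0) ⬝ᵥ u)
      (ν (k, 1) ⬝ᵥ u)).trans_eq (by simp [s]))
    simp only [withBinaryCovariate_apply, if_false, Fin.sum_univ_two, if_true,
      zero_ne_one, one_ne_zero, mul_one, mul_zero, add_zero, s, H]
    ring
  · refine le_trans (le_of_eq ?_) ((swap_pair_le hpbβ.le hpb ht γ (ν (j, 0) ⬝ᵥ u)
      (ν (j, 1) ⬝ᵥ u)).trans_eq (by simp [s, hk]))
    simp only [withBinaryCovariate_apply, hk, if_false, Fin.sum_univ_two, if_true,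
      zero_ne_one, one_ne_zero, mul_one, mul_zero, add_zero, s]
    linear_combination (-(2 * t * (1 - t) * (γ * (phi (b + β) + phi b) - β))) * hpar j

theorem rhoLim_balancedZ (hK : 2 ≤ K) : rhoLim (balancedZ K) ν =
    min ((a - b) ^ 2 / (K * (phi a + phi b + phiBeta a b β)))
      (K * β ^ 2 / (2 * D₄ K a b β)) := by
  have : Nontrivial (Fin K) := Fin.nontrivial_iff_two_le.2 hK
  obtain ⟨k, l, hkl⟩ := exists_pair_ne (Fin K)
  have : Nonempty (Fin K) := ⟨k⟩
  apply le_antisymm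
  · refine le_min ?_ ?_
    · exact rhoLim_le (k := (k, 0)) (l := (l, 0)) (fun h => hkl (congrArg Prod.fst h))
        fun t ht => leadingTerm_balancedZ_le_of_ne hb hba hβ haβ hν hK hkl ht
    · exact rhoLim_le (k := (k, 0)) (l := (k, 1)) (by simp)
        fun t ht => leadingTerm_balancedZ_le_of_eq hb hba hβ haβ hν hK k ht
  · refine le_rhoLim (t := 1 / 2) (wellPosed_balancedZ hb hba hβ haβ hν hK) (by norm_num)
      fun x y hxy => ?_
    obtain ⟨i, z⟩ := x
    obtain ⟨j, z'⟩ := y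
    by_cases hij : i = j
    · subst hij
      exact (min_le_right _ _).trans (le_leadingTerm_balancedZ_of_eq hb hba hβ haβ hν hK i
        fun h => hxy (by rw [h]))
    · exact (min_le_left _ _).trans
        (le_leadingTerm_balancedZ_of_ne hb hba hβ haβ hν hK hij z z')

omit hν in
theorem min_div_eq_closedForm (hK : 2 ≤ K) :
    min ((a - b) ^ 2 / (K * (phi a + phi b + phiBeta a b β))) (K * β ^ 2 / (2 * D₄ K a b β)) /
      ((a - b) ^ 2 / (K * (phi a + phi b))) = closedForm K a b β := by
  have hS := phi_add_phi_add_phiBeta_pos hb hba hβ haβ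
  have hD := D₄_pos hb hba hβ haβ hK
  have hK0 : (0 : ℝ) < K := Nat.cast_pos.2 (by omega)
  have hpa : 0 < phi a := phi_pos (hb.trans hba) (by linarith)
  have hpb : 0 < phi b := phi_pos hb (by linarith)
  have hab : a - b ≠ 0 := (sub_pos.2 hba).ne'
  -- Cross-multiplied, the comparison of the two candidates for the minimum is $\delta\le0$.
  have hiff : K * β ^ 2 / (2 * D₄ K a b β) ≤ (a - b) ^ 2 / (K * (phi a + phi b + phiBeta a b β)) ↔
      discr K a b β ≤ 0 := by
    rw [div_le_div_iff₀ (by positivity) (by positivity), discr, sub_nonpos]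
    constructor <;> intro h <;> linarith
  rw [closedForm]
  split_ifs with h
  · rw [min_eq_right (hiff.2 h)]
    field_simp
  · rw [min_eq_left (le_of_not_ge fun h' => h (hiff.1 h'))]
    field_simp

end WithCovariate

end ChernoffSBM

/-! ### The limiting Chernoff ratio. -/

theorem theorem2 (K : ℕ) (hK : 2 ≤ K) (a b β : ℝ)
    (hb : 0 < b) (hba : b < a) (ha : a < 1) (hβ : 0 < β) (hβ1 : β < 1) (haβ : a + β ≤ 1) :
    -- the two denominators of the closed form are positive
    0 < ChernoffSBM.D₄ K a b β ∧
    0 < ChernoffSBM.phi a + ChernoffSBM.phi b + ChernoffSBM.phiBeta a b β ∧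
    -- latent positions exist, for the model with the covariate effect and for the one without
    (∃ (p m : ℕ) (ν : Fin K × Fin 2 → Fin p ⊕ Fin m → ℝ),
      ChernoffSBM.IsLatentPosition
        (ChernoffSBM.withBinaryCovariate (ChernoffSBM.homogeneousB K a b) β) ν) ∧
    (∃ (p m : ℕ) (ν : Fin K → Fin p ⊕ Fin m → ℝ),
      ChernoffSBM.IsLatentPosition (ChernoffSBM.homogeneousB K a b) ν) ∧
    -- for every choice of them, the Chernoff ratio converges to the closed form
    ∀ (p₁ m₁ : ℕ) (ν₁ : Fin K × Fin 2 → Fin p₁ ⊕ Fin m₁ → ℝ)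
      (p₂ m₂ : ℕ) (ν₂ : Fin K → Fin p₂ ⊕ Fin m₂ → ℝ),
      ChernoffSBM.IsLatentPosition
        (ChernoffSBM.withBinaryCovariate (ChernoffSBM.homogeneousB K a b) β) ν₁ →
      ChernoffSBM.IsLatentPosition (ChernoffSBM.homogeneousB K a b) ν₂ →
      ChernoffSBM.WellPosed (ChernoffSBM.balancedZ K) ν₁ ∧
      ChernoffSBM.WellPosed (ChernoffSBM.balanced K) ν₂ ∧
      0 < ChernoffSBM.rhoLim (ChernoffSBM.balanced K) ν₂ ∧
      Tendsto
        (fun n : ℕ => ChernoffSBM.rho (ChernoffSBM.balancedZ K) ν₁ n /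
          ChernoffSBM.rho (ChernoffSBM.balanced K) ν₂ n)
        atTop (𝓝 (ChernoffSBM.closedForm K a b β)) ∧
      ChernoffSBM.rhoLim (ChernoffSBM.balancedZ K) ν₁ /
          ChernoffSBM.rhoLim (ChernoffSBM.balanced K) ν₂ =
        ChernoffSBM.closedForm K a b β := by
  have : Nontrivial (Fin K) := Fin.nontrivial_iff_two_le.2 hK
  have : Nonempty (Fin K) := ⟨⟨0, by omega⟩⟩
  have hD := ChernoffSBM.D₄_pos hb hba hβ haβ hK
  have hS := ChernoffSBM.phi_add_phi_add_phiBeta_pos hb hba hβ haβ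
  refine ⟨hD, hS,
    ChernoffSBM.exists_isLatentPosition
      (ChernoffSBM.withBinaryCovariate_homogeneousB_posSemidef hb hba hβ),
    ChernoffSBM.exists_isLatentPosition (ChernoffSBM.homogeneousB_posSemidef hb.le hba.le),
    fun p₁ m₁ ν₁ p₂ m₂ ν₂ hν₁ hν₂ => ?_⟩
  have hwp₁ := ChernoffSBM.wellPosed_balancedZ hb hba hβ haβ hν₁ hK
  have hwp₂ := ChernoffSBM.wellPosed_balanced hb hba ha hν₂
  have hrho₂ := ChernoffSBM.rhoLim_balanced hb hba ha hν₂ hK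
  have hratio : ChernoffSBM.rhoLim (ChernoffSBM.balancedZ K) ν₁ /
      ChernoffSBM.rhoLim (ChernoffSBM.balanced K) ν₂ = ChernoffSBM.closedForm K a b β := by
    rw [ChernoffSBM.rhoLim_balancedZ hb hba hβ haβ hν₁ hK, hrho₂]
    exact ChernoffSBM.min_div_eq_closedForm hb hba hβ haβ hK
  have hpos : 0 < ChernoffSBM.rhoLim (ChernoffSBM.balanced K) ν₂ := by
    have hpa := ChernoffSBM.phi_pos (hb.trans hba) ha
    have hpb := ChernoffSBM.phi_pos hb (hba.trans ha)
    have hab : 0 < a - b := sub_pos.2 hba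
    have hK0 : (0 : ℝ) < K := Nat.cast_pos.2 (by omega)
    rw [hrho₂]
    positivity
  exact ⟨hwp₁, hwp₂, hpos, hratio ▸ ChernoffSBM.tendsto_rho_div_rho hwp₁ hwp₂ hpos, hratio⟩
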